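/- Let $G^*$ be a directed acyclic graph (DAG) on a finite vertex set $V$ with $|V|\neq 2$. Two DAGs on $V$ are Markov equivalent if they represent the same conditional independence assertions, i.e. if for all pairwise disjoint $X,Y,Z\subseteq V$, $X$ and $Y$ are d-separated by $Z$ in one if and only if they are in the other; the Markov equivalence class of $G^*$ is the set of all DAGs on $V$ that are Markov equivalent to $G^*$. The essential graph $Ess(G^*)$ is the mixed graph on $V$ whose directed edges are those that have the same direction in all elements of the Markov equivalence class of $G^*$, and whose undirected edges are those whose direction differs in at least two elements of the class. A v-structure of a mixed graph is a pair of directed edges $a\to c\leftarrow b$ with $a\ne b$ and $a,b$ not joined by any edge. Consider the following random procedure. List all three-element subsets of $V$ in a random order, and start with $G'=Ess(G^*)$. Call a three-element set $T\subseteq V$ admissible if the subgraph of $G'$ induced on $T$ has no undirected edge, is not a directed cycle, and has no v-structure that is not a v-structure of $Ess(G^*)$. While some three-element set is not admissible, go through the list, and for each $T$ in it (re)orient the edges that are undirected in $Ess(G^*)$ and have both ends in $T$, independently by fair coin flips, until $T$ is admissible. When all three-element sets are admissible, return $G'$. Then every graph $G'$ that this procedure may return (for any order and any outcome of the coin flips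 for which it terminates) is a directed graph, i.e. has no undirected edges, and belongs to the Markov equivalence class of $G^*$; in particular it is acyclic. -/

import Mathlib

namespace Causal

/-! ### Directed acyclic graphs, d-separation, Markov equivalence -/

/-- A directed graph is acyclic if no directed walk of positive length returns to its start
(in particular there are no loops and no pairs of opposite edges). -/
def IsDAG {V : Type*} (G : Digraph V) : Prop :=
  ∀ v, ¬ Relation.TransGen G.Adj v v

/-- `l` is a trail of `G` from `x` to `y`: a sequence of vertices in which consecutive vertices are
joined by an edge, in either direction. Vertices may repeat; in a directed acyclic graph,
allowing or forbidding repetitions yields the same d-separation relation. -/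
def IsTrail {V : Type*} (G : Digraph V) (x y : V) (l : List V) : Prop :=
  l.head? = some x ∧ l.getLast? = some y ∧ l.IsChain (fun a b => G.Adj a b ∨ G.Adj b a)

/-- A trail is active given `Z` if each of its colliders `a → b ← c` has a descendant in `Z`
(a vertex is a descendant of itself), and no other inner vertex of it lies in `Z`. (The end vertices
are not in `Z` where this is used.) -/
def IsActive {V : Type*} (G : Digraph V) (Z : Set V) (l : List V) : Prop :=
  ∀ a b c, [a, b, c] <:+: l →
    ((G.Adj a b ∧ G.Adj c b) → ∃ d ∈ Z, Relation.ReflTransGen G.Adj b d) ∧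
    (¬ (G.Adj a b ∧ G.Adj c b) → b ∉ Z)

/-- `X` and `Y` are d-separated by `Z` in `G`: there is no active trail given `Z` between a vertex
of `X` and a vertex of `Y`. This is the assertion "`X` and `Y` are conditionally independent
given `Z`" as represented by `G`. -/
def DSep {V : Type*} (G : Digraph V) (X Y Z : Set V) : Prop :=
  ∀ x ∈ X, ∀ y ∈ Y, ∀ l, IsTrail G x y l → ¬ IsActive G Z l

/-- Two graphs are Markov equivalent if they represent the same conditional independence
assertions. -/
def MarkovEquivalent {V : Type*} (G₁ G₂ : Digraph V) : Prop :=
  ∀ X Y Z : Set V, Disjoint X Y → Disjoint X Z → Disjoint Y Z →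
    (DSep G₁ X Y Z ↔ DSep G₂ X Y Z)

/-- The Markov equivalence class of `G`: all DAGs that are Markov equivalent to `G`. -/
def markovClass {V : Type*} (G : Digraph V) : Set (Digraph V) :=
  {D | IsDAG D ∧ MarkovEquivalent D G}

/-! ### Mixed graphs and the essential graph -/

/-- A mixed graph: undirected edges and directed edges on the vertex set `V`. -/
structure MixedGraph (V : Type*) where
  /-- the undirected edges -/
  undirected : SimpleGraph V
  /-- the directed edges -/
  directed : Digraph V

/-- Two vertices of a mixed graph are adjacent if some edge, of either kind, joins them. -/
def MixedGraph.Adjacent {V : Type*} (K : MixedGraph V) (u v : V) : Prop :=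
  K.undirected.Adj u v ∨ K.directed.Adj u v ∨ K.directed.Adj v u

/-- The v-structure `a → c ← b`: two converging directed edges with nonadjacent tails. -/
def MixedGraph.IsVStructure {V : Type*} (K : MixedGraph V) (a c b : V) : Prop :=
  a ≠ b ∧ K.directed.Adj a c ∧ K.directed.Adj b c ∧ ¬ K.Adjacent a b

/-- The essential graph of `G`: an edge is directed if it has the same direction in all elements of
the Markov equivalence class of `G`, and undirected if two elements of the class disagree on its
direction. -/
def essentialGraph {V : Type*} (G : Digraph V) : MixedGraph V where
  undirected :=
    { Adj := fun u v =>
        (∃ D ∈ markovClass G, D.Adj u v) ∧ (∃ D ∈ markovClass G, D.Adj v u)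
      symm := ⟨fun _ _ h => ⟨h.2, h.1⟩⟩
      loopless := ⟨fun _ h => h.1.elim fun _ hD => hD.1.1 _ (Relation.TransGen.single hD.2)⟩ }
  directed := { Adj := fun u v => ∀ D ∈ markovClass G, D.Adj u v }

/-! ### The sampler of the fast estimator

The sampler works on a current mixed graph `K`, which at the start is the essential graph `H`.
It is described by the set of its possible runs, over all outcomes of the random shuffle and of the
coin flips. -/

/-- The subgraph of `K` induced on `T` is directed, is not a directed cycle, and has no v-structure
that is not a v-structure of `H`. -/
def Admissible {V : Type*} (H K : MixedGraph V) (T : Finset V) : Prop :=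
  (∀ u ∈ T, ∀ v ∈ T, ¬ K.undirected.Adj u v) ∧
  (¬ ∃ a ∈ T, ∃ b ∈ T, ∃ c ∈ T, K.directed.Adj a b ∧ K.directed.Adj b c ∧ K.directed.Adj c a) ∧
  (∀ a ∈ T, ∀ b ∈ T, ∀ c ∈ T, K.IsVStructure a c b → H.IsVStructure a c b)

/-- `K'` is a possible result of flipping a coin for each edge that is undirected in `H` and has
both ends in `T`, and orienting that edge accordingly; all other edges are as in `K`. -/
def FlipsTo {V : Type*} (H : MixedGraph V) (T : Finset V) (K K' : MixedGraph V) : Prop :=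
  (∀ u v, (H.undirected.Adj u v ∧ u ∈ T ∧ v ∈ T) →
    ¬ K'.undirected.Adj u v ∧ (K'.directed.Adj u v ↔ ¬ K'.directed.Adj v u)) ∧
  (∀ u v, ¬ (H.undirected.Adj u v ∧ u ∈ T ∧ v ∈ T) →
    (K'.undirected.Adj u v ↔ K.undirected.Adj u v) ∧
    (K'.directed.Adj u v ↔ K.directed.Adj u v))

/-- `K'` is a possible result of flipping on `T` until the outcome on `T` is admissible.
(Leaving alone an already admissible `T`, or the edges in `T` that already have a direction,
can only lead to graphs `K'` of this kind as well.) -/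
def OrientsTo {V : Type*} (H : MixedGraph V) (T : Finset V) (K K' : MixedGraph V) : Prop :=
  FlipsTo H T K K' ∧ Admissible H K' T

/-- The inner loop: `K'` is a possible result of treating the sets of the list one by one. -/
inductive ForLoop {V : Type*} (H : MixedGraph V) :
    List (Finset V) → MixedGraph V → MixedGraph V → Prop
  | nil (K : MixedGraph V) : ForLoop H [] K K
  | cons {T : Finset V} {L : List (Finset V)} {K K' K'' : MixedGraph V} :
      OrientsTo H T K K' → ForLoop H L K' K'' → ForLoop H (T :: L) K K''

/-- The outer loop: while some set of three vertices is not admissible, run the inner loop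
through the list `L`. `WhileLoop H L K K'` says that some run started at `K` ends with `K'`. -/
inductive WhileLoop {V : Type*} (H : MixedGraph V) (L : List (Finset V)) :
    MixedGraph V → MixedGraph V → Prop
  | done {K : MixedGraph V} :
      (∀ T : Finset V, T.card = 3 → Admissible H K T) → WhileLoop H L K K
  | loop {K K' K'' : MixedGraph V} :
      (¬ ∀ T : Finset V, T.card = 3 → Admissible H K T) →
      ForLoop H L K K' → WhileLoop H L K' K'' → WhileLoop H L K K''

/-- `K` is a graph that the sampler, given the mixed graph `H`, may generate: for some order `L` of
the three-element sets of vertices, some run started at `H` ends with `K`. -/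
def IsGenerated {V : Type*} (H K : MixedGraph V) : Prop :=
  ∃ L : List (Finset V), L.Nodup ∧ (∀ T, T ∈ L ↔ T.card = 3) ∧ WhileLoop H L H K

end Causal

/-!
The proof rests on the theorem of Verma and Pearl: two DAGs are Markov equivalent if and only if they
have the same pattern, that is, the same skeleton and the same v-structures.

*Markov equivalence determines the pattern.* Adjacent vertices are never d-separated, while two
nonadjacent vertices of a DAG are separated by the parents of one of them, a set that contains no
common child of the two (`IsDAG.exists_separator`). So the skeleton is determined by d-separation,
and so is the question whether the middle vertex of `a, c, b`, with `a` and `b` nonadjacent, is a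
collider.

*The pattern determines d-separation* (`SamePattern.exists_walk`). Among the active trails of `G₁`
between two vertices take a shortest one and, among these, one whose vertices have the least total
distance to the conditioning set `Z` along directed walks. Comparison with its shortcuts shows that
its colliders are unshielded, hence colliders in `G₂` too, and that its non-colliders are
non-colliders in `G₂`: a shielded one must be a fork whose relevant edge is forced by a neighbouring
v-structure. The choice of the least distance makes the first edge of a shortest directed walk from
a collider to `Z` keep its direction in `G₂`, and then all edges of that walk keep theirs. So the
trail is active in `G₂`.

*The output of the sampler is a DAG with the right pattern.* The sampler only gives directions to
undirected edges of the essential graph, so it preserves the skeleton and the directed edges. When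
all triples are admissible, no undirected edge is left (each lies in a triple, as there are not
exactly two vertices), there are no new v-structures and there are no directed triangles. Such a
graph is acyclic (`SamePattern.isDAG`): a sink of the original DAG among the vertices of a directed
cycle can be bypassed, since its two neighbours on the cycle are adjacent, so that the cycle shrinks
until it is impossible. By the converse half of the theorem the graph is in the Markov equivalence
class.
-/

namespace Causal

open Relation

variable {V : Type*} {G G₁ G₂ : Digraph V} {Z : Set V} {x y : V} {n : ℕ} {f : ℕ → V}
  {H K K' : MixedGraph V} {T : Finset V} {L : List (Finset V)}

/-! ### Adjacency, immoralities and directed paths -/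

/-- Two vertices are joined if there is an edge between them, in either direction: adjacency in the
skeleton. -/
def Joined (G : Digraph V) (u v : V) : Prop :=
  G.Adj u v ∨ G.Adj v u

/-- The v-structure `a → c ← b` of a directed graph: converging edges with nonadjacent tails. -/
def Immorality (G : Digraph V) (a c b : V) : Prop :=
  a ≠ b ∧ G.Adj a c ∧ G.Adj b c ∧ ¬ Joined G a b

/-- Two directed graphs have the same pattern if they have the same skeleton and the same
v-structures. -/
structure SamePattern (G₁ G₂ : Digraph V) : Prop where
  joined : ∀ u v, Joined G₁ u v ↔ Joined G₂ u v
  immorality : ∀ a c b, Immorality G₁ a c b ↔ Immorality G₂ a c b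

theorem Joined.symm {u v : V} (h : Joined G u v) : Joined G v u :=
  Or.symm h

theorem SamePattern.symm (h : SamePattern G₁ G₂) : SamePattern G₂ G₁ :=
  ⟨fun u v => (h.joined u v).symm, fun a c b => (h.immorality a c b).symm⟩

theorem IsDAG.ne (hG : IsDAG G) {u v : V} (h : G.Adj u v) : u ≠ v := by
  rintro rfl
  exact hG _ (.single h)

theorem IsDAG.asymm (hG : IsDAG G) {u v : V} (h : G.Adj u v) : ¬ G.Adj v u :=
  fun h' => hG _ (.tail (.single h) h')

theorem IsDAG.no_triangle (hG : IsDAG G) {u v w : V} (h : G.Adj u v) (h' : G.Adj v w) :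
    ¬ G.Adj w u :=
  fun h'' => hG _ (.tail (.tail (.single h) h') h'')

/-- An edge `b → w` following an edge `a → b` keeps its direction when `a` and `w` are nonadjacent:
otherwise it would create the v-structure `a → b ← w`. -/
theorem SamePattern.adj_of_not_joined (h : SamePattern G₁ G₂) (hG₁ : IsDAG G₁) {a b w : V}
    (hab : G₁.Adj a b) (hab' : G₂.Adj a b) (hbw : G₁.Adj b w) (haw : ¬ Joined G₁ a w) :
    G₂.Adj b w := by
  rcases (h.joined b w).1 (.inl hbw) with hbw' | hwb'
  · exact hbw'
  · have hne : a ≠ w := by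
      rintro rfl
      exact hG₁.asymm hab hbw
    have := (h.immorality a b w).2 ⟨hne, hab', hwb', fun hj => haw ((h.joined a w).2 hj)⟩
    exact absurd this.2.2.1 (hG₁.asymm hbw)

/-! ### Walks -/

/-- The condition that an active trail given `Z` has to satisfy where it runs through `a, b, c`. -/
def Passes (G : Digraph V) (Z : Set V) (a b c : V) : Prop :=
  ((G.Adj a b ∧ G.Adj c b) → ∃ d ∈ Z, ReflTransGen G.Adj b d) ∧
    (¬ (G.Adj a b ∧ G.Adj c b) → b ∉ Z)

/-- The vertices `f 0, …, f n` form an active trail given `Z` from `x` to `y`. The values of `f`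
beyond `n` play no role. -/
structure IsActiveWalk (G : Digraph V) (Z : Set V) (x y : V) (n : ℕ) (f : ℕ → V) : Prop where
  start : f 0 = x
  finish : f n = y
  joined : ∀ i, i < n → Joined G (f i) (f (i + 1))
  passes : ∀ i, i + 2 ≤ n → Passes G Z (f i) (f (i + 1)) (f (i + 2))

theorem Passes.symm {a b c : V} (h : Passes G Z a b c) : Passes G Z c b a :=
  ⟨fun h' => h.1 h'.symm, fun h' => h.2 fun h'' => h' h''.symm⟩

/-- Whether a trail may run through `a, b, c` depends on `a` only via the direction of its edge
to `b`. -/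
theorem Passes.congr_left {a a' b c : V} (h : Passes G Z a b c) (ha : G.Adj a b ↔ G.Adj a' b) :
    Passes G Z a' b c := by
  unfold Passes at *
  rwa [← ha]

theorem Passes.congr_right {a b c c' : V} (h : Passes G Z a b c) (hc : G.Adj c b ↔ G.Adj c' b) :
    Passes G Z a b c' :=
  (h.symm.congr_left hc).symm

theorem passes_of_notMem {a b c : V} (h : ¬ (G.Adj a b ∧ G.Adj c b)) (hb : b ∉ Z) :
    Passes G Z a b c :=
  ⟨fun h' => absurd h' h, fun _ => hb⟩

theorem passes_of_collider {a b c d : V} (hab : G.Adj a b) (hcb : G.Adj c b) (hd : d ∈ Z)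
    (h : ReflTransGen G.Adj b d) : Passes G Z a b c :=
  ⟨fun _ => ⟨d, hd, h⟩, fun h' => absurd ⟨hab, hcb⟩ h'⟩

theorem exists_trail_iff_exists_walk :
    (∃ l, IsTrail G x y l ∧ IsActive G Z l) ↔ ∃ n f, IsActiveWalk G Z x y n f := by
  constructor
  · rintro ⟨l, ⟨hx, hy, hc⟩, ha⟩
    have hpos : 0 < l.length := by
      cases l with
      | nil => simp at hx
      | cons => simp
    have hf : ∀ i, (h : i < l.length) → l[i]?.getD x = l[i] := fun i h => by simp [h]
    rw [List.head?_eq_getElem?] at hx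
    rw [List.getLast?_eq_getElem?] at hy
    rw [List.isChain_iff_getElem] at hc
    refine ⟨l.length - 1, fun i => l[i]?.getD x, by simp [hx], by simp [hy], ?_, ?_⟩
    · intro i hi
      have h1 : i + 1 < l.length := by omega
      rw [hf i (by omega), hf (i + 1) h1]
      exact hc i h1
    · intro i hi
      have h2 : i + 2 < l.length := by omega
      rw [hf i (by omega), hf (i + 1) (by omega), hf (i + 2) h2]
      refine ha _ _ _ (List.infix_iff_getElem?.2 ⟨i, by simp; omega, ?_⟩)
      intro j hj
      have hj3 : j < 3 := by simpa using hj
      interval_cases j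
      · simp
      · simp [add_comm 1 i, show i + 1 < l.length by omega]
      · simp [add_comm 2 i, h2]
  · rintro ⟨n, f, h⟩
    refine ⟨(List.range (n + 1)).map f, ⟨?_, ?_, ?_⟩, ?_⟩
    · simp [List.head?_eq_getElem?, h.start]
    · simp [List.getLast?_eq_getElem?, h.finish]
    · rw [List.isChain_iff_getElem]
      intro i hi
      simp only [List.getElem_map, List.getElem_range]
      exact h.joined i (by simpa using hi)
    · intro a b c habc
      obtain ⟨k, hk, hl⟩ := List.infix_iff_getElem?.1 habc
      simp only [List.length_cons, List.length_nil, List.length_map, List.length_range] at hk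
      have h0 := hl 0 (by simp)
      have h1 := hl 1 (by simp)
      have h2 := hl 2 (by simp)
      rw [List.getElem?_eq_getElem (by simp; omega)] at h0 h1 h2
      simp only [List.getElem_map, List.getElem_range, Option.some.injEq, List.getElem_cons_zero,
        List.getElem_cons_succ] at h0 h1 h2
      have := h.passes k (by omega)
      rw [zero_add] at h0
      rw [add_comm 1 k] at h1
      rw [add_comm 2 k] at h2
      rwa [h0, h1, h2] at this

theorem dsep_iff {X Y : Set V} :
    DSep G X Y Z ↔ ∀ x ∈ X, ∀ y ∈ Y, ¬ ∃ n f, IsActiveWalk G Z x y n f := by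
  simp only [← exists_trail_iff_exists_walk, DSep, not_exists, not_and]

theorem IsActiveWalk.reverse (h : IsActiveWalk G Z x y n f) :
    IsActiveWalk G Z y x n (fun i => f (n - i)) where
  start := by simp [h.finish]
  finish := by simp [h.start]
  joined i hi := by
    have := h.joined (n - (i + 1)) (by omega)
    rw [show n - (i + 1) + 1 = n - i by omega] at this
    exact this.symm
  passes i hi := by
    have := h.passes (n - (i + 2)) (by omega)
    rw [show n - (i + 2) + 1 = n - (i + 1) by omega,
      show n - (i + 2) + 2 = n - i by omega] at this
    exact this.symm

/-! ### Markov equivalent graphs have the same pattern -/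

/-- Adjacent vertices are never separated: the edge itself is an active trail. -/
theorem Joined.exists_walk {u v : V} (h : Joined G u v) :
    ∃ n f, IsActiveWalk G Z u v n f := by
  refine ⟨1, fun i => if i = 0 then u else v, by simp, by simp, ?_, fun i hi => by omega⟩
  intro i hi
  obtain rfl : i = 0 := by omega
  simpa using h

/-- The parents of `v` separate `v` from every nonadjacent non-descendant `u`. An active trail
starting at `v` cannot leave through a parent, so it leaves through a child; and it can never turn
around, as the first collider would be an ancestor of a parent of `v`. -/
theorem IsDAG.not_exists_walk_parents (hG : IsDAG G) {u v : V} (huv : u ≠ v)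
    (hj : ¬ Joined G v u) (hd : ¬ TransGen G.Adj v u) :
    ¬ ∃ n f, IsActiveWalk G {w | G.Adj w v} v u n f := by
  rintro ⟨n, f, h⟩
  have hn0 : n ≠ 0 := by
    rintro rfl
    exact huv (h.finish.symm.trans h.start)
  have hn1 : n ≠ 1 := by
    rintro rfl
    have := h.joined 0 (by omega)
    rw [h.start, zero_add, h.finish] at this
    exact hj this
  have key : ∀ i, i < n → G.Adj (f i) (f (i + 1)) ∧ TransGen G.Adj v (f (i + 1)) := by
    intro i
    induction i with
    | zero =>
      intro hi
      rcases h.joined 0 hi with h1 | h1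
      · exact ⟨h1, by rw [← h.start]; exact .single h1⟩
      · have hp := (h.passes 0 (by omega)).2 fun hc => hG.asymm h1 hc.1
        exact absurd (by simpa [h.start] using h1) hp
    | succ i ih =>
      intro hi
      obtain ⟨h0, h1⟩ := ih (by omega)
      rcases h.joined (i + 1) hi with h2 | h2
      · exact ⟨h2, h1.tail h2⟩
      · obtain ⟨d, hd, hr⟩ := (h.passes i (by omega)).1 ⟨h0, h2⟩
        exact absurd (TransGen.tail (h1.trans_left hr) hd) (hG v)
  have := (key (n - 1) (by omega)).2
  rw [show n - 1 + 1 = n by omega, h.finish] at this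
  exact hd this

/-- Nonadjacent vertices of a DAG are separated by a set that contains none of their common
children. -/
theorem IsDAG.exists_separator (hG : IsDAG G) {u v : V} (huv : u ≠ v) (hj : ¬ Joined G u v) :
    ∃ Z : Set V, u ∉ Z ∧ v ∉ Z ∧ (∀ c, G.Adj u c → G.Adj v c → c ∉ Z) ∧ DSep G {u} {v} Z := by
  by_cases hd : TransGen G.Adj v u
  · refine ⟨{w | G.Adj w u}, fun h => hG.ne h rfl, fun h => hj (.inr h),
      fun c hc _ hc' => hG.asymm hc hc', dsep_iff.2 ?_⟩
    rintro _ rfl _ rfl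
    exact hG.not_exists_walk_parents huv.symm hj fun h => hG _ (h.trans hd)
  · refine ⟨{w | G.Adj w v}, fun h => hj (.inl h), fun h => hG.ne h rfl,
      fun c _ hc hc' => hG.asymm hc hc', dsep_iff.2 ?_⟩
    rintro _ rfl _ rfl ⟨n, f, h⟩
    exact hG.not_exists_walk_parents huv (fun h => hj h.symm) hd ⟨n, _, h.reverse⟩

theorem MarkovEquivalent.symm (h : MarkovEquivalent G₁ G₂) : MarkovEquivalent G₂ G₁ :=
  fun X Y Z h₁ h₂ h₃ => (h X Y Z h₁ h₂ h₃).symm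

theorem MarkovEquivalent.joined_imp (h : MarkovEquivalent G₁ G₂) (hG₁ : IsDAG G₁)
    (hG₂ : IsDAG G₂) {u v : V} (huv : Joined G₁ u v) : Joined G₂ u v := by
  by_contra hj
  have hne : u ≠ v := by
    rintro rfl
    exact huv.elim (fun h => hG₁.ne h rfl) (fun h => hG₁.ne h rfl)
  obtain ⟨Z, hu, hv, -, hs⟩ := hG₂.exists_separator hne hj
  exact dsep_iff.1 ((h {u} {v} Z (by simpa using hne) (by simpa) (by simpa)).2 hs) u rfl v rfl
    huv.exists_walk

theorem MarkovEquivalent.immorality_imp (h : MarkovEquivalent G₁ G₂) (hG₁ : IsDAG G₁)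
    (hG₂ : IsDAG G₂) {a c b : V} (hi : Immorality G₁ a c b) : Immorality G₂ a c b := by
  obtain ⟨hne, hac, hbc, hj⟩ := hi
  have hac' := h.joined_imp hG₁ hG₂ (.inl hac)
  have hbc' := h.joined_imp hG₁ hG₂ (.inl hbc)
  have hj' : ¬ Joined G₂ a b := fun hj' => hj (h.symm.joined_imp hG₂ hG₁ hj')
  obtain ⟨Z, ha, hb, hc, hs⟩ := hG₁.exists_separator hne hj
  have hs' := dsep_iff.1 ((h {a} {b} Z (by simpa using hne) (by simpa) (by simpa)).1 hs) a rfl b rfl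
  -- The separator avoids `c`, so the trail `a, c, b` is blocked only if `c` is a collider on it.
  suffices hcol : G₂.Adj a c ∧ G₂.Adj b c from ⟨hne, hcol.1, hcol.2, hj'⟩
  by_contra hcol
  refine hs' ⟨2, fun i => if i = 0 then a else if i = 1 then c else b, by simp, by simp, ?_, ?_⟩
  · intro i hi
    interval_cases i
    · simpa using hac'
    · simpa using hbc'.symm
  · intro i hi
    obtain rfl : i = 0 := by omega
    simpa using passes_of_notMem hcol (hc c hac hbc)

theorem MarkovEquivalent.samePattern (h : MarkovEquivalent G₁ G₂) (hG₁ : IsDAG G₁)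
    (hG₂ : IsDAG G₂) : SamePattern G₁ G₂ where
  joined _ _ := ⟨h.joined_imp hG₁ hG₂, h.symm.joined_imp hG₂ hG₁⟩
  immorality _ _ _ := ⟨h.immorality_imp hG₁ hG₂, h.symm.immorality_imp hG₂ hG₁⟩

/-! ### Shortest active trails -/

/-- An active walk that has the least number of edges among those with the same ends. -/
structure IsShortest (G : Digraph V) (Z : Set V) (x y : V) (n : ℕ) (f : ℕ → V) : Prop
    extends IsActiveWalk G Z x y n f where
  le : ∀ m g, IsActiveWalk G Z x y m g → n ≤ m

theorem IsShortest.reverse (h : IsShortest G Z x y n f) :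
    IsShortest G Z y x n (fun i => f (n - i)) :=
  ⟨h.toIsActiveWalk.reverse, fun m _ hg => h.le m _ hg.reverse⟩

/-- Skipping `k` vertices of an active walk: only the two vertices that become consecutive have to
be checked. -/
theorem IsActiveWalk.skip (h : IsActiveWalk G Z x y n f) {i k : ℕ} (hk : i + 1 + k ≤ n)
    (hj : Joined G (f i) (f (i + 1 + k)))
    (hl : ∀ j, j + 1 = i → Passes G Z (f j) (f i) (f (i + 1 + k)))
    (hr : i + 2 + k ≤ n → Passes G Z (f i) (f (i + 1 + k)) (f (i + 2 + k))) :
    IsActiveWalk G Z x y (n - k) (fun j => if j ≤ i then f j else f (j + k)) where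
  start := by simp [h.start]
  finish := by
    rw [if_neg (by omega), show n - k + k = n by omega, h.finish]
  joined j hjn := by
    rcases lt_trichotomy j i with hji | rfl | hji
    · rw [if_pos (by omega), if_pos (by omega)]
      exact h.joined j (by omega)
    · rwa [if_pos le_rfl, if_neg (by omega)]
    · rw [if_neg (by omega), if_neg (by omega), show j + 1 + k = j + k + 1 by omega]
      exact h.joined (j + k) (by omega)
  passes j hjn := by
    rcases lt_trichotomy j i with hji | rfl | hji
    · rcases Nat.lt_or_ge (j + 1) i with hji' | hji'
      · rw [if_pos (by omega), if_pos (by omega), if_pos (by omega)]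
        exact h.passes j (by omega)
      · obtain rfl : j + 1 = i := by omega
        rw [if_pos (by omega), if_pos (by omega), if_neg (by omega)]
        exact hl j rfl
    · rw [if_pos le_rfl, if_neg (by omega), if_neg (by omega)]
      exact hr (by omega)
    · rw [if_neg (by omega), if_neg (by omega), if_neg (by omega),
        show j + 1 + k = j + k + 1 by omega, show j + 2 + k = j + k + 2 by omega]
      exact h.passes (j + k) (by omega)

/-- On a shortest active walk, a shortcut has to violate the condition at one of its ends. -/
theorem IsShortest.false_of_skip (h : IsShortest G Z x y n f) {i k : ℕ} (hk0 : 0 < k)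
    (hk : i + 1 + k ≤ n) (hj : Joined G (f i) (f (i + 1 + k)))
    (hl : ∀ j, j + 1 = i → Passes G Z (f j) (f i) (f (i + 1 + k)))
    (hr : i + 2 + k ≤ n → Passes G Z (f i) (f (i + 1 + k)) (f (i + 2 + k))) : False := by
  have := h.le _ _ (h.skip hk hj hl hr)
  omega

/-- A shortest active walk does not turn back along an edge. -/
theorem IsShortest.ne (h : IsShortest G Z x y n f) (hG : IsDAG G) {i : ℕ} (hi : i + 2 ≤ n) :
    f i ≠ f (i + 2) := by
  intro he
  rcases hi.eq_or_lt with rfl | hi'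
  · have := h.le i f ⟨h.start, he.trans h.finish, fun j hj => h.joined j (by omega),
      fun j hj => h.passes j (by omega)⟩
    omega
  refine h.false_of_skip (i := i) (k := 2) two_pos hi' ?_ ?_ ?_
  · rw [he]
    exact h.joined (i + 2) hi'
  · rintro j rfl
    -- The vertex `f (j + 1)` occurs twice; write `b` for the vertex between the two occurrences.
    have h₁ := h.passes j (by omega)
    have h₂ := h.passes (j + 1) (by omega)
    have h₃ := h.passes (j + 2) (by omega)
    have hb := h.joined (j + 1) (by omega)
    rw [show j + 1 + 2 = j + 3 by omega] at he
    simp only [add_assoc, Nat.reduceAdd] at *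
    rw [← he] at h₂ h₃
    rcases hb with hb | hb
    · have hmem := h₁.2 fun hc => hG.asymm hb hc.2
      obtain ⟨d, hd, hr⟩ := h₂.1 ⟨hb, hb⟩
      exact ⟨fun _ => ⟨d, hd, .head hb hr⟩, fun _ => hmem⟩
    · by_cases hp : G.Adj (f j) (f (j + 1))
      · exact h₃.congr_left ⟨fun _ => hp, fun _ => hb⟩
      · exact passes_of_notMem (fun hc => hp hc.1) (h₁.2 fun hc => hp hc.1)
  · intro hi''
    rw [he]
    exact h.passes (i + 2) (by omega)

/-- Auxiliary form of `IsShortest.not_joined`, with the shortcut edge in one of its two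
directions. -/
theorem IsShortest.not_adj (h : IsShortest G Z x y n f) (hG : IsDAG G) {i : ℕ} (hi : i + 2 ≤ n)
    (ha : G.Adj (f i) (f (i + 1))) (hc : G.Adj (f (i + 2)) (f (i + 1))) :
    ¬ G.Adj (f i) (f (i + 2)) := by
  intro hac
  refine h.false_of_skip (i := i) (k := 1) one_pos hi (.inl hac) ?_ ?_
  · rintro j rfl
    exact (h.passes j (by omega)).congr_right
      ⟨fun hc => absurd hc (hG.asymm ha), fun hc => absurd hc (hG.asymm hac)⟩
  · intro hi'
    obtain ⟨d, hd, hr⟩ := (h.passes i hi).1 ⟨ha, hc⟩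
    have hmem := (h.passes (i + 1) (by omega)).2 fun hcol => hG.asymm hc hcol.1
    exact ⟨fun _ => ⟨d, hd, .head hc hr⟩, fun _ => hmem⟩

/-- Colliders of a shortest active walk are unshielded. -/
theorem IsShortest.not_joined (h : IsShortest G Z x y n f) (hG : IsDAG G) {i : ℕ} (hi : i + 2 ≤ n)
    (ha : G.Adj (f i) (f (i + 1))) (hc : G.Adj (f (i + 2)) (f (i + 1))) :
    ¬ Joined G (f i) (f (i + 2)) := by
  rintro (hj | hj)
  · exact h.not_adj hG hi ha hc hj
  · have := h.reverse.not_adj hG (i := n - (i + 2)) (by omega)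
    rw [show n - (n - (i + 2)) = i + 2 by omega, show n - (n - (i + 2) + 1) = i + 1 by omega,
      show n - (n - (i + 2) + 2) = i by omega] at this
    exact this hc ha hj

/-- A shortest active walk has no shielded directed part `a → b → c`. -/
theorem IsShortest.not_adj_chain (h : IsShortest G Z x y n f) (hG : IsDAG G) {i : ℕ}
    (hi : i + 2 ≤ n) (ha : G.Adj (f i) (f (i + 1))) (hc : G.Adj (f (i + 1)) (f (i + 2))) :
    ¬ Joined G (f i) (f (i + 2)) := by
  rintro (hac | hca)
  · refine h.false_of_skip (i := i) (k := 1) one_pos hi (.inl hac) ?_ ?_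
    · rintro j rfl
      exact (h.passes j (by omega)).congr_right
        ⟨fun hc => absurd hc (hG.asymm ha), fun hc => absurd hc (hG.asymm hac)⟩
    · intro hi'
      exact (h.passes (i + 1) (by omega)).congr_left ⟨fun _ => hac, fun _ => hc⟩
  · exact hG.no_triangle ha hc hca

/-- In a shielded fork `a ← b → c` with `a → c` on a shortest active walk, the edge `b → c` has
the same direction in every DAG with the same pattern. The shortcut `a → c` can be forbidden only
because `a` is a collider in `Z`, say with preceding vertex `p`. Then `p → a ← b` is a v-structure,
`p` and `c` are nonadjacent, and the directions `b → a`, `a → c` and `b → c` are forced in turn. -/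
theorem IsShortest.adj_of_fork (h : IsShortest G₁ Z x y n f) (hP : SamePattern G₁ G₂)
    (hG₁ : IsDAG G₁) (hG₂ : IsDAG G₂) {i : ℕ} (hi : i + 2 ≤ n)
    (ha : G₁.Adj (f (i + 1)) (f i)) (hc : G₁.Adj (f (i + 1)) (f (i + 2)))
    (hac : G₁.Adj (f i) (f (i + 2))) : G₂.Adj (f (i + 1)) (f (i + 2)) := by
  have hr : i + 3 ≤ n → Passes G₁ Z (f i) (f (i + 2)) (f (i + 3)) := fun hi' =>
    (h.passes (i + 1) (by omega)).congr_left ⟨fun _ => hac, fun _ => hc⟩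
  by_contra hbc'
  refine h.false_of_skip (i := i) (k := 1) one_pos hi (.inl hac) ?_ hr
  rintro j rfl
  simp only [add_assoc, Nat.reduceAdd] at *
  refine passes_of_notMem (fun hcol => hG₁.asymm hac hcol.2) fun hmem => hbc' ?_
  -- From here on `p, a, b, c` are the values of `f` at `j`, `j + 1`, `j + 2`, `j + 3`.
  have hpa : G₁.Adj (f j) (f (j + 1)) := by
    by_contra hpa
    exact (h.passes j (by omega)).2 (fun hcol => hpa hcol.1) hmem
  have hv : Immorality G₁ (f j) (f (j + 1)) (f (j + 2)) :=
    ⟨h.ne hG₁ (by omega), hpa, ha, h.not_joined hG₁ (by omega) hpa ha⟩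
  obtain ⟨-, hpa', hba', -⟩ := (hP.immorality _ _ _).1 hv
  have hpc : ¬ Joined G₁ (f j) (f (j + 3)) := by
    rintro (hpc | hcp)
    · refine h.false_of_skip (i := j) (k := 2) two_pos (by omega) (.inl hpc) ?_ ?_
      · rintro k rfl
        exact (h.passes k (by omega)).congr_right
          ⟨fun hc => absurd hc (hG₁.asymm hpa), fun hc => absurd hc (hG₁.asymm hpc)⟩
      · intro hi'
        exact (h.passes (j + 2) (by omega)).congr_left ⟨fun _ => hpc, fun _ => hc⟩
    · exact hG₁.no_triangle hpa hac hcp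
  have hac' : G₂.Adj (f (j + 1)) (f (j + 3)) :=
    hP.adj_of_not_joined hG₁ hpa hpa' hac hpc
  rcases (hP.joined _ _).1 (.inl hc) with hbc' | hcb'
  · exact hbc'
  · exact absurd hcb' (hG₂.no_triangle hba' hac')

/-- A non-collider of a shortest active walk is a non-collider in every DAG with the same
pattern. -/
theorem IsShortest.not_collider (h : IsShortest G₁ Z x y n f) (hP : SamePattern G₁ G₂)
    (hG₁ : IsDAG G₁) (hG₂ : IsDAG G₂) {i : ℕ} (hi : i + 2 ≤ n)
    (hcol : ¬ (G₁.Adj (f i) (f (i + 1)) ∧ G₁.Adj (f (i + 2)) (f (i + 1)))) :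
    ¬ (G₂.Adj (f i) (f (i + 1)) ∧ G₂.Adj (f (i + 2)) (f (i + 1))) := by
  rintro ⟨ha', hc'⟩
  have hrev : ∀ j, j ≤ i + 2 → n - (n - (i + 2) + j) = i + 2 - j := fun j hj => by omega
  by_cases hj : Joined G₁ (f i) (f (i + 2))
  · have hc := h.joined (i + 1) (by omega)
    rcases h.joined i (by omega) with ha | ha
    · rcases hc with hc | hc
      · exact h.not_adj_chain hG₁ hi ha hc hj
      · exact hcol ⟨ha, hc⟩
    · rcases hc with hc | hc
      · rcases hj with hj | hj
        · exact hG₂.asymm hc' (h.adj_of_fork hP hG₁ hG₂ hi ha hc hj)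
        · have := h.reverse.adj_of_fork hP hG₁ hG₂ (i := n - (i + 2)) (by omega)
          rw [hrev 1 (by omega), hrev 2 (by omega), show n - (n - (i + 2)) = i + 2 by omega] at this
          exact hG₂.asymm ha' (this hc ha hj)
      · have := h.reverse.not_adj_chain hG₁ (i := n - (i + 2)) (by omega)
        rw [hrev 1 (by omega), hrev 2 (by omega), show n - (n - (i + 2)) = i + 2 by omega] at this
        exact this hc ha hj.symm
  · have := (hP.immorality _ _ _).2
      ⟨h.ne hG₁ hi, ha', hc', fun hj' => hj ((hP.joined _ _).2 hj')⟩
    exact hcol ⟨this.2.1, this.2.2.1⟩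

/-! ### Distances from colliders to the conditioning set -/

/-- The vertices from which a directed walk with `k` edges leads into `Z`. -/
def ancestorsAt (G : Digraph V) (Z : Set V) : ℕ → Set V
  | 0 => Z
  | k + 1 => {v | ∃ w ∈ ancestorsAt G Z k, G.Adj v w}

/-- The length of a shortest directed walk from `v` into `Z`. It is `0` if there is none. -/
noncomputable def distTo (G : Digraph V) (Z : Set V) (v : V) : ℕ :=
  sInf {k | v ∈ ancestorsAt G Z k}

theorem exists_mem_ancestorsAt_iff {v : V} :
    (∃ k, v ∈ ancestorsAt G Z k) ↔ ∃ d ∈ Z, ReflTransGen G.Adj v d := by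
  constructor
  · rintro ⟨k, hk⟩
    induction k generalizing v with
    | zero => exact ⟨v, hk, .refl⟩
    | succ k ih =>
      obtain ⟨w, hw, hvw⟩ := hk
      obtain ⟨d, hd, hr⟩ := ih hw
      exact ⟨d, hd, .head hvw hr⟩
  · rintro ⟨d, hd, hr⟩
    induction hr using ReflTransGen.head_induction_on with
    | refl => exact ⟨0, hd⟩
    | head h _ ih =>
      obtain ⟨k, hk⟩ := ih
      exact ⟨k + 1, _, hk, h⟩

theorem distTo_le {v : V} {k : ℕ} (h : v ∈ ancestorsAt G Z k) : distTo G Z v ≤ k :=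
  Nat.sInf_le h

theorem mem_ancestorsAt_distTo {v : V} {k : ℕ} (h : v ∈ ancestorsAt G Z k) :
    v ∈ ancestorsAt G Z (distTo G Z v) :=
  Nat.sInf_mem (s := {k | v ∈ ancestorsAt G Z k}) ⟨k, h⟩

theorem exists_adj_distTo {v : V} {k : ℕ} (h : v ∈ ancestorsAt G Z (k + 1))
    (hd : distTo G Z v = k + 1) :
    ∃ w, G.Adj v w ∧ w ∈ ancestorsAt G Z k ∧ distTo G Z w = k := by
  obtain ⟨w, hw, hvw⟩ := h
  refine ⟨w, hvw, hw, (distTo_le hw).antisymm ?_⟩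
  have := distTo_le (k := distTo G Z w + 1) ⟨w, mem_ancestorsAt_distTo hw, hvw⟩
  omega

/-- If the first edge of a shortest directed walk into `Z` keeps its direction, then so do all
others: by minimality, no two consecutive edges of the walk are shielded. -/
theorem SamePattern.exists_descendant (hP : SamePattern G₁ G₂) (hG₁ : IsDAG G₁) {b w : V} {k : ℕ}
    (hb : distTo G₁ Z b = k + 1) (hw : w ∈ ancestorsAt G₁ Z k) (hwd : distTo G₁ Z w = k)
    (hbw : G₁.Adj b w) (hbw' : G₂.Adj b w) : ∃ d ∈ Z, ReflTransGen G₂.Adj b d := by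
  induction k generalizing b w with
  | zero => exact ⟨w, hw, .single hbw'⟩
  | succ k ih =>
    obtain ⟨t, hwt, ht, htd⟩ := exists_adj_distTo hw hwd
    have hbt : ¬ Joined G₁ b t := by
      rintro (hbt | htb)
      · have := distTo_le (k := k + 1) ⟨t, ht, hbt⟩
        omega
      · exact hG₁.no_triangle hbw hwt htb
    obtain ⟨d, hd, hr⟩ := ih hwd ht htd hwt (hP.adj_of_not_joined hG₁ hbw hbw' hwt hbt)
    exact ⟨d, hd, .head hbw' hr⟩

/-- A collider of an active walk may be moved one step down a directed walk to `Z`, if its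
neighbours on the walk are parents of the new vertex as well. -/
theorem IsActiveWalk.update (h : IsActiveWalk G Z x y n f) (hG : IsDAG G) {i : ℕ} (hi : i + 2 ≤ n)
    {w : V} (ha : G.Adj (f i) (f (i + 1))) (hc : G.Adj (f (i + 2)) (f (i + 1)))
    (haw : G.Adj (f i) w) (hcw : G.Adj (f (i + 2)) w)
    (hw : ∃ d ∈ Z, ReflTransGen G.Adj w d) :
    IsActiveWalk G Z x y n (Function.update f (i + 1) w) := by
  have hu : ∀ j, j ≠ i + 1 → Function.update f (i + 1) w j = f j := fun j hj =>
    Function.update_of_ne hj _ _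
  refine ⟨by rw [hu _ (by omega), h.start], by rw [hu _ (by omega), h.finish], ?_, ?_⟩
  · intro j hj
    by_cases h1 : j = i + 1
    · subst h1
      rw [Function.update_self, hu _ (by omega)]
      exact .inr hcw
    by_cases h2 : j = i
    · subst h2
      rw [Function.update_self, hu _ (by omega)]
      exact .inl haw
    rw [hu _ h1, hu _ (by omega)]
    exact h.joined j hj
  · intro j hj
    by_cases h1 : j = i + 1
    · subst h1
      rw [Function.update_self, hu _ (by omega), hu _ (by omega)]
      exact (h.passes (i + 1) hj).congr_left
        ⟨fun h' => absurd h' (hG.asymm hc), fun h' => absurd h' (hG.asymm hcw)⟩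
    by_cases h2 : j = i
    · subst h2
      rw [Function.update_self, hu _ (by omega), hu _ (by omega)]
      obtain ⟨d, hd, hr⟩ := hw
      exact passes_of_collider haw hcw hd hr
    by_cases h3 : j + 1 = i
    · subst h3
      rw [Function.update_self, hu _ (by omega), hu _ (by omega)]
      exact (h.passes j hj).congr_right
        ⟨fun h' => absurd h' (hG.asymm ha), fun h' => absurd h' (hG.asymm haw)⟩
    rw [hu _ h1, hu _ (by omega), hu _ (by omega)]
    exact h.passes j hj

/-! ### DAGs with the same pattern are Markov equivalent -/

/-- Among the shortest active walks, take one whose vertices have the least total distance to `Z`.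
It is active in every DAG with the same pattern. -/
theorem SamePattern.exists_walk (hP : SamePattern G₁ G₂) (hG₁ : IsDAG G₁) (hG₂ : IsDAG G₂)
    (h : ∃ n f, IsActiveWalk G₁ Z x y n f) : ∃ n f, IsActiveWalk G₂ Z x y n f := by
  classical
  obtain ⟨f₀, hf₀⟩ := Nat.find_spec h
  set n := Nat.find h
  have hmin : ∀ m g, IsActiveWalk G₁ Z x y m g → n ≤ m := fun m g hg => Nat.find_min' h ⟨g, hg⟩
  obtain ⟨f, hf, hfmin⟩ :=
    (measure fun f : ℕ → V => ∑ j ∈ Finset.range (n + 1), distTo G₁ Z (f j)).wf.has_min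
      {f | IsActiveWalk G₁ Z x y n f} ⟨f₀, hf₀⟩
  have hs : IsShortest G₁ Z x y n f := ⟨hf, hmin⟩
  refine ⟨n, f, hs.start, hs.finish, fun i hi => (hP.joined _ _).1 (hs.joined i hi), ?_⟩
  intro i hi
  by_cases hcol : G₁.Adj (f i) (f (i + 1)) ∧ G₁.Adj (f (i + 2)) (f (i + 1))
  swap
  · exact passes_of_notMem (hs.not_collider hP hG₁ hG₂ hi hcol) ((hs.passes i hi).2 hcol)
  have hdesc := (hs.passes i hi).1 hcol
  obtain ⟨ha, hc⟩ := hcol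
  have hj := hs.not_joined hG₁ hi ha hc
  obtain ⟨-, ha', hc', -⟩ := (hP.immorality _ _ _).1 ⟨hs.ne hG₁ hi, ha, hc, hj⟩
  suffices hd : ∃ d ∈ Z, ReflTransGen G₂.Adj (f (i + 1)) d by
    obtain ⟨d, hd, hr⟩ := hd
    exact passes_of_collider ha' hc' hd hr
  obtain ⟨k, hk⟩ := exists_mem_ancestorsAt_iff.2 hdesc
  have hb := mem_ancestorsAt_distTo hk
  rcases hdist : distTo G₁ Z (f (i + 1)) with _ | k
  · rw [hdist] at hb
    exact ⟨_, hb, .refl⟩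
  rw [hdist] at hb
  obtain ⟨w, hbw, hw, hwd⟩ := exists_adj_distTo hb hdist
  refine hP.exists_descendant hG₁ hdist hw hwd hbw ?_
  by_cases haw : Joined G₁ (f i) w
  swap
  · exact hP.adj_of_not_joined hG₁ ha ha' hbw haw
  by_cases hcw : Joined G₁ (f (i + 2)) w
  swap
  · exact hP.adj_of_not_joined hG₁ hc hc' hbw hcw
  -- Both neighbours are parents of `w`, so the collider can be moved to `w`, closer to `Z`.
  have haw' := haw.resolve_right (hG₁.no_triangle ha hbw)
  have hcw' := hcw.resolve_right (hG₁.no_triangle hc hbw)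
  have hnew := hf.update hG₁ hi ha hc haw' hcw' (exists_mem_ancestorsAt_iff.1 ⟨k, hw⟩)
  refine (hfmin _ hnew ?_).elim
  change ∑ j ∈ Finset.range (n + 1), distTo G₁ Z (Function.update f (i + 1) w j) <
    ∑ j ∈ Finset.range (n + 1), distTo G₁ Z (f j)
  refine Finset.sum_lt_sum (fun j _ => ?_) ⟨i + 1, Finset.mem_range.2 (by omega), ?_⟩
  · by_cases hj : j = i + 1
    · subst hj
      rw [Function.update_self]
      omega
    · rw [Function.update_of_ne hj]
  · rw [Function.update_self]
    omega

theorem SamePattern.markovEquivalent (hP : SamePattern G₁ G₂) (hG₁ : IsDAG G₁) (hG₂ : IsDAG G₂) :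
    MarkovEquivalent G₁ G₂ := by
  intro X Y Z _ _ _
  rw [dsep_iff, dsep_iff]
  exact ⟨fun h x hx y hy hw => h x hx y hy (hP.symm.exists_walk hG₂ hG₁ hw),
    fun h x hx y hy hw => h x hx y hy (hP.exists_walk hG₁ hG₂ hw)⟩

/-! ### Acyclicity from the absence of directed triangles -/

/-- A finite nonempty set of vertices of a DAG contains a vertex without children in the set. -/
theorem IsDAG.exists_sink (hG : IsDAG G) {S : Finset V} (hS : S.Nonempty) :
    ∃ s ∈ S, ∀ t ∈ S, ¬ G.Adj s t := by
  have : IsTrans S (fun a b => TransGen G.Adj b.1 a.1) := ⟨fun _ _ _ h h' => h'.trans h⟩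
  have : Std.Irrefl (fun a b : S => TransGen G.Adj b.1 a.1) := ⟨fun a => hG a.1⟩
  have hwf := Finite.wellFounded_of_trans_of_irrefl (fun a b : S => TransGen G.Adj b.1 a.1)
  obtain ⟨s, hs⟩ := hS
  obtain ⟨m, -, hm⟩ := hwf.has_min Set.univ ⟨⟨s, hs⟩, trivial⟩
  exact ⟨m.1, m.2, fun t ht h => hm ⟨t, ht⟩ trivial (.single h)⟩

/-- A directed graph without opposite edges and without directed triangles that has the pattern of
a DAG `G₂` is acyclic on every finite set `S` of vertices. By induction on `S`: let `s` be a sink of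
`G₂` in `S`. If a directed walk of `G₁` passes through `u → s → v`, then `u` and `v` are adjacent,
since otherwise `u → s ← v` would be a v-structure of `G₂` and not of `G₁`. As there are no directed
triangles, `u → v`, so `s` can be bypassed. -/
theorem SamePattern.not_transGen_restrict (hP : SamePattern G₁ G₂) (hG₂ : IsDAG G₂)
    (hasymm : ∀ u v, G₁.Adj u v → ¬ G₁.Adj v u)
    (htri : ∀ u v w, G₁.Adj u v → G₁.Adj v w → ¬ G₁.Adj w u) (S : Finset V) (v : V) :
    ¬ TransGen (fun a b => a ∈ S ∧ b ∈ S ∧ G₁.Adj a b) v v := by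
  classical
  induction S using Finset.strongInduction generalizing v with
  | H S ih =>
    intro hcyc
    have hvS : v ∈ S := by
      obtain ⟨b, hb, -⟩ := TransGen.head'_iff.1 hcyc
      exact hb.1
    obtain ⟨s, hs, hsink⟩ := hG₂.exists_sink ⟨v, hvS⟩
    have hirr : ∀ u w, G₁.Adj u w → u ≠ w := by
      rintro u _ h rfl
      exact hasymm u u h h
    have bypass : ∀ u ∈ S, ∀ w ∈ S, G₁.Adj u s → G₁.Adj s w → G₁.Adj u w := by
      intro u hu w hw hus hsw
      have hus' := ((hP.joined _ _).1 (.inl hus)).resolve_right (hsink u hu)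
      have hws' := ((hP.joined _ _).1 (.inl hsw)).resolve_left (hsink w hw)
      have hne : u ≠ w := by
        rintro rfl
        exact hasymm _ _ hus hsw
      by_cases hj : Joined G₁ u w
      · exact hj.resolve_right (htri _ _ _ hus hsw)
      · have := (hP.immorality _ _ _).2
          ⟨hne, hus', hws', fun hj' => hj ((hP.joined _ _).2 hj')⟩
        exact absurd this.2.2.1 (hasymm _ _ hsw)
    have hcut : ∀ u w, u ∈ S → u ≠ s → TransGen (fun a b => a ∈ S ∧ b ∈ S ∧ G₁.Adj a b) u w →
        (w ≠ s ∧ TransGen (fun a b => a ∈ S.erase s ∧ b ∈ S.erase s ∧ G₁.Adj a b) u w) ∨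
        (w = s ∧ ∃ t ∈ S.erase s, G₁.Adj t s ∧
          ReflTransGen (fun a b => a ∈ S.erase s ∧ b ∈ S.erase s ∧ G₁.Adj a b) u t) := by
      intro u w hu hus h
      induction h with
      | @single w h =>
        by_cases hws : w = s
        · subst hws
          exact .inr ⟨rfl, u, by simp [hu, hus], h.2.2, .refl⟩
        · exact .inl ⟨hws, .single ⟨by simp [hu, hus], by simp [h.2.1, hws], h.2.2⟩⟩
      | @tail p w _ h ih' =>
        by_cases hws : w = s
        · subst hws
          rcases ih' with ⟨hp, hup⟩ | ⟨rfl, -⟩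
          · exact .inr ⟨rfl, p, by simp [h.1, hp], h.2.2, hup.to_reflTransGen⟩
          · exact absurd rfl (hirr _ _ h.2.2)
        · rcases ih' with ⟨hp, hup⟩ | ⟨rfl, t, ht, hts, hut⟩
          · exact .inl ⟨hws, .tail hup ⟨by simp [h.1, hp], by simp [h.2.1, hws], h.2.2⟩⟩
          · exact .inl ⟨hws, .tail' hut ⟨ht, by simp [h.2.1, hws],
              bypass _ (Finset.mem_of_mem_erase ht) _ h.2.1 hts h.2.2⟩⟩
    by_cases hvs : v = s
    · subst hvs
      obtain ⟨b, hb, hbv⟩ := TransGen.head'_iff.1 hcyc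
      have hbne : b ≠ v := (hirr _ _ hb.2.2).symm
      rcases reflTransGen_iff_eq_or_transGen.1 hbv with rfl | hbv
      · exact hbne rfl
      rcases hcut b v hb.2.1 hbne hbv with ⟨h, -⟩ | ⟨-, t, ht, htv, hbt⟩
      · exact h rfl
      · exact ih _ (Finset.erase_ssubset hs) b (.tail' hbt ⟨ht, by simp [hb.2.1, hbne],
          bypass _ (Finset.mem_of_mem_erase ht) _ hb.2.1 htv hb.2.2⟩)
    · rcases hcut v v hvS hvs hcyc with ⟨-, h⟩ | ⟨h, -⟩
      · exact ih _ (Finset.erase_ssubset hs) v h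
      · exact hvs h

theorem SamePattern.isDAG [Fintype V] (hP : SamePattern G₁ G₂) (hG₂ : IsDAG G₂)
    (hasymm : ∀ u v, G₁.Adj u v → ¬ G₁.Adj v u)
    (htri : ∀ u v w, G₁.Adj u v → G₁.Adj v w → ¬ G₁.Adj w u) : IsDAG G₁ := by
  intro v h
  refine hP.not_transGen_restrict hG₂ hasymm htri Finset.univ v ?_
  simpa using h

/-! ### The essential graph -/

theorem self_mem_markovClass (hG : IsDAG G) : G ∈ markovClass G :=
  ⟨hG, fun _ _ _ _ _ _ => Iff.rfl⟩

theorem samePattern_of_mem_markovClass (hG : IsDAG G) {D : Digraph V} (hD : D ∈ markovClass G) :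
    SamePattern D G :=
  hD.2.samePattern hD.1 hG

theorem adjacent_essentialGraph_iff (hG : IsDAG G) {u v : V} :
    (essentialGraph G).Adjacent u v ↔ Joined G u v := by
  constructor
  · rintro (⟨⟨D, hD, h⟩, -⟩ | h | h)
    · exact ((samePattern_of_mem_markovClass hG hD).joined _ _).1 (.inl h)
    · exact .inl (h G (self_mem_markovClass hG))
    · exact .inr (h G (self_mem_markovClass hG))
  · intro hj
    by_cases h : ∀ D ∈ markovClass G, D.Adj u v
    · exact .inr (.inl h)
    by_cases h' : ∀ D ∈ markovClass G, D.Adj v u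
    · exact .inr (.inr h')
    push Not at h h'
    obtain ⟨D, hD, hDuv⟩ := h
    obtain ⟨D', hD', hDvu⟩ := h'
    exact .inl
      ⟨⟨D', hD', (((samePattern_of_mem_markovClass hG hD').joined _ _).2 hj).resolve_right hDvu⟩,
        ⟨D, hD, (((samePattern_of_mem_markovClass hG hD).joined _ _).2 hj).resolve_left hDuv⟩⟩

theorem isVStructure_essentialGraph_iff (hG : IsDAG G) {a c b : V} :
    (essentialGraph G).IsVStructure a c b ↔ Immorality G a c b := by
  constructor
  · rintro ⟨hne, hac, hbc, hj⟩
    exact ⟨hne, hac G (self_mem_markovClass hG), hbc G (self_mem_markovClass hG),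
      fun h => hj ((adjacent_essentialGraph_iff hG).2 h)⟩
  · intro h
    have hD : ∀ D ∈ markovClass G, Immorality D a c b := fun D hD =>
      ((samePattern_of_mem_markovClass hG hD).immorality _ _ _).2 h
    exact ⟨h.1, fun D h' => (hD D h').2.1, fun D h' => (hD D h').2.2.1,
      fun hj => h.2.2.2 ((adjacent_essentialGraph_iff hG).1 hj)⟩

/-! ### The graphs visited by the sampler -/

/-- `K` arises from `H` by giving directions to some of the undirected edges: every undirected edge
of `H` is still undirected in `K` or has exactly one direction there, and `K` agrees with `H` at all
other pairs of vertices. -/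
structure PartiallyOrients (H K : MixedGraph V) : Prop where
  of_undirected : ∀ u v, H.undirected.Adj u v →
    (K.undirected.Adj u v ∧ ¬ K.directed.Adj u v ∧ ¬ K.directed.Adj v u) ∨
    (¬ K.undirected.Adj u v ∧ (K.directed.Adj u v ↔ ¬ K.directed.Adj v u))
  of_not_undirected : ∀ u v, ¬ H.undirected.Adj u v →
    ¬ K.undirected.Adj u v ∧ (K.directed.Adj u v ↔ H.directed.Adj u v)

theorem partiallyOrients_essentialGraph (G : Digraph V) :
    PartiallyOrients (essentialGraph G) (essentialGraph G) where
  of_undirected := by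
    rintro u v h
    obtain ⟨⟨D, hD, huv⟩, ⟨D', hD', hvu⟩⟩ := id h
    exact .inl ⟨h, fun h' => hD'.1.asymm hvu (h' D' hD'), fun h' => hD.1.asymm huv (h' D hD)⟩
  of_not_undirected u v h := ⟨h, Iff.rfl⟩

theorem PartiallyOrients.flipsTo (h : PartiallyOrients H K) (hf : FlipsTo H T K K') :
    PartiallyOrients H K' where
  of_undirected u v huv := by
    by_cases hT : u ∈ T ∧ v ∈ T
    · exact .inr (hf.1 u v ⟨huv, hT⟩)
    · rw [(hf.2 u v fun h' => hT h'.2).1, (hf.2 u v fun h' => hT h'.2).2,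
        (hf.2 v u fun h' => hT h'.2.symm).2]
      exact h.of_undirected u v huv
  of_not_undirected u v huv := by
    rw [(hf.2 u v fun h' => huv h'.1).1, (hf.2 u v fun h' => huv h'.1).2]
    exact h.of_not_undirected u v huv

theorem PartiallyOrients.forLoop (h : PartiallyOrients H K) (hl : ForLoop H L K K') :
    PartiallyOrients H K' := by
  induction hl with
  | nil => exact h
  | cons ho _ ih => exact ih (h.flipsTo ho.1)

theorem PartiallyOrients.whileLoop (h : PartiallyOrients H K) (hl : WhileLoop H L K K') :
    PartiallyOrients H K' := by
  induction hl with
  | done => exact h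
  | loop _ hf _ ih => exact ih (h.forLoop hf)

theorem admissible_of_whileLoop (hl : WhileLoop H L K K') :
    ∀ T : Finset V, T.card = 3 → Admissible H K' T := by
  induction hl with
  | done h => exact h
  | loop _ _ _ ih => exact ih

theorem PartiallyOrients.adjacent_iff (h : PartiallyOrients H K) {u v : V} :
    K.Adjacent u v ↔ H.Adjacent u v := by
  unfold MixedGraph.Adjacent
  by_cases huv : H.undirected.Adj u v
  · have := h.of_undirected u v huv
    tauto
  · have h₁ := h.of_not_undirected u v huv
    have h₂ := h.of_not_undirected v u fun h' => huv h'.symm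
    tauto

/-- Triangles without undirected edges leave no undirected edge at all, unless there are just two
vertices. -/
theorem undirected_eq_bot [Fintype V] (hV : Fintype.card V ≠ 2)
    (hadm : ∀ T : Finset V, T.card = 3 → Admissible H K T) : K.undirected = ⊥ := by
  classical
  ext u v
  simp only [SimpleGraph.bot_adj, iff_false]
  intro huv
  have h2 : ({u, v} : Finset V).card = 2 := Finset.card_pair huv.ne
  have h3 : 3 ≤ Fintype.card V := by
    have := Finset.card_le_univ ({u, v} : Finset V)
    omega
  obtain ⟨T, hT, hT3⟩ := Finset.exists_superset_card_eq (s := {u, v}) (by omega) h3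
  exact (hadm T hT3).1 u (hT (by simp)) v (hT (by simp)) huv

end Causal

theorem lemma3 {V : Type*} [Fintype V] (hV : Fintype.card V ≠ 2)
    (Gstar : Digraph V) (hG : Causal.IsDAG Gstar)
    (K : Causal.MixedGraph V)
    (hK : Causal.IsGenerated (Causal.essentialGraph Gstar) K) :
    K.undirected = ⊥ ∧ K.directed ∈ Causal.markovClass Gstar := by
  classical
  obtain ⟨L, -, -, hrun⟩ := hK
  have hadm := Causal.admissible_of_whileLoop hrun
  have hpo := (Causal.partiallyOrients_essentialGraph Gstar).whileLoop hrun
  have hbot := Causal.undirected_eq_bot hV hadm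
  have hadj : ∀ u v, Causal.Joined K.directed u v ↔ K.Adjacent u v := fun u v => by
    simp [Causal.Joined, Causal.MixedGraph.Adjacent, hbot]
  have hjoined : ∀ u v, Causal.Joined K.directed u v ↔ Causal.Joined Gstar u v := fun u v => by
    rw [hadj, hpo.adjacent_iff, Causal.adjacent_essentialGraph_iff hG]
  have hasymm : ∀ u v, K.directed.Adj u v → ¬ K.directed.Adj v u := by
    intro u v huv hvu
    by_cases h : (Causal.essentialGraph Gstar).undirected.Adj u v
    · have := hpo.of_undirected u v h
      tauto
    · have h₁ := (hpo.of_not_undirected u v h).2.1 huv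
      have h₂ := (hpo.of_not_undirected v u fun h' => h h'.symm).2.1 hvu
      exact hG.asymm (h₁ _ (Causal.self_mem_markovClass hG)) (h₂ _ (Causal.self_mem_markovClass hG))
  have hne : ∀ u v, K.directed.Adj u v → u ≠ v := by
    rintro u _ h rfl
    exact hasymm u u h h
  have htri : ∀ u v w, K.directed.Adj u v → K.directed.Adj v w → ¬ K.directed.Adj w u := by
    intro u v w huv hvw hwu
    have h3 : ({u, v, w} : Finset V).card = 3 :=
      Finset.card_eq_three.2 ⟨u, v, w, hne _ _ huv, (hne _ _ hwu).symm, hne _ _ hvw, rfl⟩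
    exact (hadm _ h3).2.1 ⟨u, by simp, v, by simp, w, by simp, huv, hvw, hwu⟩
  have hP : Causal.SamePattern K.directed Gstar := by
    refine ⟨hjoined, fun a c b => ⟨fun h => ?_, fun h => ?_⟩⟩
    · obtain ⟨hab, hac, hbc, hj⟩ := h
      have h3 : ({a, c, b} : Finset V).card = 3 :=
        Finset.card_eq_three.2 ⟨a, c, b, hne _ _ hac, hab, (hne _ _ hbc).symm, rfl⟩
      exact (Causal.isVStructure_essentialGraph_iff hG).1 <|
        (hadm _ h3).2.2 a (by simp) b (by simp) c (by simp)
          ⟨hab, hac, hbc, fun h' => hj ((hadj _ _).2 h')⟩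
    · obtain ⟨hab, hac, hbc, -⟩ := (Causal.isVStructure_essentialGraph_iff hG).2 h
      -- A directed edge of the essential graph is not undirected there, so it keeps its direction.
      have keep : ∀ u v, (Causal.essentialGraph Gstar).directed.Adj u v → K.directed.Adj u v := by
        intro u v huv
        refine (hpo.of_not_undirected u v ?_).2.2 huv
        rintro ⟨-, D, hD, hvu⟩
        exact hD.1.asymm hvu (huv D hD)
      exact ⟨hab, keep _ _ hac, keep _ _ hbc, fun hj => h.2.2.2 ((hjoined _ _).1 hj)⟩
  have hDAG := hP.isDAG hG hasymm htri
  exact ⟨hbot, hDAG, hP.markovEquivalent hDAG hG⟩
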